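/- Let $A\colon\mathbb R^n\to\mathbb R^n$, $B\colon\mathbb R^m\to\mathbb R^n$, $C\colon\mathbb R^k\to\mathbb R^n$ be linear (constant matrices), $p>1$, $\rho>0$, $\sigma>0$, and let $M=M^0+M^1$, where $M^0$ is a linear subspace of $\mathbb R^n$ and $M^1$ is a closed convex subset of $L=(M^0)^\perp$. Consider the game $$\dot z=Az+Bu-Cv,\qquad z(0)=z_0\in\mathbb R^n .$$ Controls $u\in L_p([0,\infty);\mathbb R^m)$ and $v\in L_p([0,\infty);\mathbb R^k)$ are called admissible if $\int_0^\infty|u|^p\,d\tau\le\rho^p$ and $\int_0^\infty|v|^p\,d\tau\le\sigma^p$ respectively. Pursuit from $z_0$ can be completed by time $T$ if there is a rule $(t,v_t)\mapsto u(t,v_t)$, depending only on $t$ and on the restriction $v_t=v|_{[0,t]}$, such that for every admissible $v$ the control $t\mapsto u(t,v_t)$ is admissible and the absolutely continuous solution on $[0,T]$ of $\dot z=Az+Bu(t,v_t)-Cv(t)$, $z(0)=z_0$, satisfies $z(t^*)\in M$ for some $t^*\in[0,T]$. Let $\pi$ be the orthogonal projection of $\mathbb R^n$ onto $L$. Assume: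 (1) $F(t)$, $t\ge0$, is a continuous family of linear maps $\mathbb R^k\to\mathbb R^m$ with $\pi e^{tA}BF(t)=\pi e^{tA}C$ for all $t\ge0$. (2) $\rho^p>\sigma^p\nu^p$, where $$\nu^p=\sup_{t\ge0}\ \sup_{\int_0^t|\omega|^p\,d\tau\le1}\ \int_0^t|F(t-\tau)\omega(\tau)|^p\,d\tau .$$ Put $\delta=\rho^p-\sigma^p\nu^p$, let $S$ be the closed unit ball of $\mathbb R^m$, and for $t$ with $\pi e^{tA}z_0\notin M^1$, $0\le\tau\le t$ and $v\in\mathbb R^k$ let $$U(t,\tau,v,\lambda)=\bigl(|F(t-\tau)v|^p+\lambda\delta\bigr)^{1/p}\,\pi e^{(t-\tau)A}BS-\pi e^{(t-\tau)A}Cv,$$ $$\lambda(t,\tau,v,z_0)=\max\bigl\{\lambda\ge0:\ \lambda\,(M^1-\pi e^{tA}z_0)\cap U(t,\tau,v,\lambda)\ne\emptyset\bigr\},$$ $$\Lambda(t,z_0)=1-\inf_{\int_0^t|v|^p\,d\tau\le\sigma^p}\ \int_0^t\lambda(t,\tau,v(\tau),z_0)\,d\tau .$$ (3) There is a first positive root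 $T=T(z_0)<\infty$ of the equation $\Lambda(t,z_0)=0$, i.e. a least element $T$ of the set of those $t>0$ for which $\pi e^{tA}z_0\notin M^1$ and $\Lambda(t,z_0)=0$. Then pursuit from $z_0$ can be completed by time $T(z_0)$. -/

import Mathlib

open Set MeasureTheory
open scoped ENNReal Pointwise

noncomputable section

/-- The Euclidean space `ℝᵈ`. -/
abbrev Euc (d : ℕ) : Type := EuclideanSpace ℝ (Fin d)

/-- The functions of class `L_p` on `J ⊆ ℝ`, with values in `ℝᵈ`,
whose integral `∫_J |w|^p` is at most `r^p`. -/
def controlBall {d : ℕ} (p : ℝ) (J : Set ℝ) (r : ℝ) : Set (ℝ → Euc d) :=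
  {w | MemLp w (ENNReal.ofReal p) (volume.restrict J) ∧ ∫ τ in J, ‖w τ‖ ^ p ≤ r ^ p}

/-- The data of the linear pursuit game `ż = A z + B u - C v` with the constraints
`∫ |u|^p ≤ ρ^p`, `∫ |v|^p ≤ σ^p` and the terminal set `M = M0 + M1`.
The matrices are given as linear maps between Euclidean spaces. -/
structure PursuitGame (n m k : ℕ) where
  A : Euc n →L[ℝ] Euc n
  B : Euc m →L[ℝ] Euc n
  C : Euc k →L[ℝ] Euc n
  p : ℝ
  ρ : ℝ
  σ : ℝ
  M0 : Submodule ℝ (Euc n)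
  M1 : Set (Euc n)

namespace PursuitGame

variable {n m k : ℕ} (G : PursuitGame n m k)

/-- The terminal set `M = M0 + M1`. -/
def terminalSet : Set (Euc n) := (G.M0 : Set (Euc n)) + G.M1

/-- Admissible controls of the pursuer. -/
def AdmissibleU (u : ℝ → Euc m) : Prop := u ∈ controlBall G.p (Ici 0) G.ρ

/-- Admissible controls of the evader. -/
def AdmissibleV (v : ℝ → Euc k) : Prop := v ∈ controlBall G.p (Ici 0) G.σ

/-- `z` is an absolutely continuous solution on `[0, T]` of the Cauchy problem
`ż = A z + B u - C v`, `z(0) = z₀`. -/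
def IsTrajectory (T : ℝ) (z₀ : Euc n) (u : ℝ → Euc m) (v : ℝ → Euc k) (z : ℝ → Euc n) : Prop :=
  AbsolutelyContinuousOnInterval z 0 T ∧ z 0 = z₀ ∧
    ∀ᵐ t ∂(volume.restrict (Icc 0 T)), HasDerivAt z (G.A (z t) + G.B (u t) - G.C (v t)) t

/-- A rule assigning to each time `t` and each restriction `v_t = (v(τ))_{0 ≤ τ ≤ t}` of an
evader's control the value `u(t, v_t)` of the pursuer's control. -/
def Strategy (m k : ℕ) : Type := (t : ℝ) → (Icc (0 : ℝ) t → Euc k) → Euc m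

/-- The pursuer's control `t ↦ u(t, v_t)` which the strategy yields against `v`. -/
def Strategy.response {m k : ℕ} (S : Strategy m k) (v : ℝ → Euc k) : ℝ → Euc m :=
  fun t => S t ((Icc 0 t).domRestrict v)

/-- Pursuit from `z₀` can be completed by time `T`: some strategy of the pursuer answers every
admissible control of the evader by an admissible control for which the (existing)
absolutely continuous trajectory reaches the terminal set at some time of `[0, T]`. -/
def CanCompletePursuit (z₀ : Euc n) (T : ℝ) : Prop :=
  ∃ S : Strategy m k, ∀ v : ℝ → Euc k, G.AdmissibleV v →
    G.AdmissibleU (S.response v) ∧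
    (∃ z, G.IsTrajectory T z₀ (S.response v) v z) ∧
    ∀ z, G.IsTrajectory T z₀ (S.response v) v z → ∃ t ∈ Icc 0 T, z t ∈ G.terminalSet

/-- The orthogonal projection `π` of `ℝⁿ` onto the orthogonal complement `L` of `M0`. -/
def proj : Euc n →L[ℝ] Euc n := G.M0ᗮ.starProjection

/-- The map `π e^{tA}`. -/
def projFlow (t : ℝ) : Euc n →L[ℝ] Euc n := G.proj ∘L NormedSpace.exp (t • G.A)

/-- `F` is continuous on `[0, ∞)` and solves `π e^{tA} B F(t) = π e^{tA} C` there. -/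
def IsMatching (F : ℝ → (Euc k →L[ℝ] Euc m)) : Prop :=
  ContinuousOn F (Ici 0) ∧ ∀ t, 0 ≤ t → G.projFlow t ∘L G.B ∘L F t = G.projFlow t ∘L G.C

/-- `χ^p(t)`, the supremum of `∫₀ᵗ |F(t-τ) ω(τ)|^p dτ` over `∫₀ᵗ |ω|^p ≤ 1`. -/
def chiPow (F : ℝ → (Euc k →L[ℝ] Euc m)) (t : ℝ) : ℝ≥0∞ :=
  ⨆ ω ∈ controlBall (d := k) G.p (Icc 0 t) 1, ∫⁻ τ in Icc 0 t, ‖F (t - τ) (ω τ)‖ₑ ^ G.p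

/-- `ν^p`, the supremum of `χ^p(t)` over `t ≥ 0`, possibly infinite. -/
def nuPow (F : ℝ → (Euc k →L[ℝ] Euc m)) : ℝ≥0∞ := ⨆ t ∈ Ici (0 : ℝ), G.chiPow F t

/-- `δ = ρ^p - σ^p ν^p`. -/
def delta (F : ℝ → (Euc k →L[ℝ] Euc m)) : ℝ :=
  G.ρ ^ G.p - G.σ ^ G.p * (G.nuPow F).toReal

/-- The set
`U(t,τ,v,lam) = (|F(t-τ)v|^p + lam δ)^{1/p} π e^{(t-τ)A} B S - π e^{(t-τ)A} C v`,
with `S` the closed unit ball. -/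
def setU (F : ℝ → (Euc k →L[ℝ] Euc m)) (t τ : ℝ) (v : Euc k) (lam : ℝ) : Set (Euc n) :=
  (‖F (t - τ) v‖ ^ G.p + lam * G.delta F) ^ (1 / G.p) •
      ((fun s => G.projFlow (t - τ) (G.B s)) '' Metric.closedBall (0 : Euc m) 1)
    - {G.projFlow (t - τ) (G.C v)}

/-- The resolving function `λ(t,τ,v,z₀)`: the largest `lam ≥ 0` for which
`lam (M1 - π e^{tA} z₀)` meets `U(t,τ,v,lam)`. -/
def resolving (F : ℝ → (Euc k →L[ℝ] Euc m)) (z₀ : Euc n) (t τ : ℝ) (v : Euc k) : ℝ :=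
  sSup {lam : ℝ | 0 ≤ lam ∧
    ((lam • (G.M1 - {G.projFlow t z₀})) ∩ G.setU F t τ v lam).Nonempty}

/-- `Λ(t,z₀) = 1 - inf ∫₀ᵗ λ(t,τ,v(τ),z₀) dτ` over `∫₀ᵗ |v|^p ≤ σ^p`. -/
def bigLambda (F : ℝ → (Euc k →L[ℝ] Euc m)) (z₀ : Euc n) (t : ℝ) : ℝ :=
  1 - sInf ((fun v : ℝ → Euc k => ∫ τ in Icc 0 t, G.resolving F z₀ t τ (v τ)) ''
    controlBall G.p (Icc 0 t) G.σ)

/-- `T` is the first positive root of `Λ(t,z₀) = 0`. The function `λ(t,·,·,z₀)`, hence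
`Λ(t,z₀)`, is defined at the times `t` with `π e^{tA} z₀ ∉ M1`. -/
def IsFirstRoot (F : ℝ → (Euc k →L[ℝ] Euc m)) (z₀ : Euc n) (T : ℝ) : Prop :=
  IsLeast {t : ℝ | 0 < t ∧ G.projFlow t z₀ ∉ G.M1 ∧ G.bigLambda F z₀ t = 0} T

end PursuitGame

end

/-!
The proof is the method of resolving functions. Put `x = π e^{TA} z₀`, a point outside `M1`, and
for a control `v` of the evader write `λ(τ) = λ(T,τ,v(τ),z₀)`. While `∫₀ᵗ λ ≤ 1`, the pursuer
answers `v(τ)` by a control `u(τ)` with `|u(τ)|^p ≤ |F(T-τ)v(τ)|^p + λ(τ) δ` for which the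
projected velocity `π e^{(T-τ)A} (B u(τ) - C v(τ))` lies in `λ(τ) (M1 - x)`; such a control exists
because the supremum defining `λ` is attained where it is positive
(`PursuitGame.exists_control_of_resolving_pos`). Afterwards the pursuer plays `F(T-τ)v(τ)`, which
cancels the projected influence of the evader, and after the time `T` he plays `0`.

Since `Λ(T,z₀) = 0`, every admissible `v` accumulates `∫₀ᵀ λ ≥ 1`, so the switch occurs at some
`s ≤ T` with `∫₀ˢ λ = 1`. The total cost is at most `σ^p ν^p + δ ∫₀ˢ λ = ρ^p`, and by the variation
of constants formula `π z(T) = x + ∫₀ˢ λ(τ) (m(τ) - x) dτ` with `m(τ) ∈ M1`. This is a mean of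
points of the closed convex set `M1` (`PursuitGame.mem_terminalSet_of_integral_eq_one`), whence
`z(T) ∈ M`. The rule uses `v` on `[0, t]` only, as it looks at nothing but `v(t)` and
`∫₀ᵗ λ`.

Two points need care. The answer `u` has to be measurable: it is chosen of least norm in a closed
convex set depending on `(λ(τ), v(τ), τ)` with closed graph, and such a choice is Borel
(`exists_measurable_norm_le_selection`). The measurability of `λ` along `v` needs no proof, for
a value `∫₀ᵀ λ ≥ 1` of the Bochner integral already means that `λ` is integrable. And all
absolutely continuous trajectories must be covered: they exist (`exists_solution`) and
their endpoint is unique (`solution_unique`).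
-/

noncomputable section

/-! ### Linear systems with an integrable inhomogeneity -/

theorem MeasureTheory.AEStronglyMeasurable.clm_apply {α E F : Type*} [MeasurableSpace α]
    {μ : Measure α} [NormedAddCommGroup E] [NormedSpace ℝ E] [NormedAddCommGroup F]
    [NormedSpace ℝ F] {Φ : α → E →L[ℝ] F} {f : α → E} (hΦ : AEStronglyMeasurable Φ μ)
    (hf : AEStronglyMeasurable f μ) : AEStronglyMeasurable (fun a => Φ a (f a)) μ :=
  (ContinuousLinearMap.apply ℝ F).flip.aestronglyMeasurable_comp₂ hΦ hf

theorem AbsolutelyContinuousOnInterval.fun_sum {ι E : Type*} [SeminormedAddCommGroup E]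
    {f : ι → ℝ → E} {a b : ℝ} (s : Finset ι)
    (hf : ∀ i ∈ s, AbsolutelyContinuousOnInterval (f i) a b) :
    AbsolutelyContinuousOnInterval (fun t => ∑ i ∈ s, f i t) a b := by
  classical
  induction s using Finset.induction_on with
  | empty =>
    simpa using (LipschitzWith.const (0 : E)).lipschitzOnWith.absolutelyContinuousOnInterval
  | insert i s hi ih =>
    simp only [Finset.sum_insert hi]
    exact (hf i (by simp)).fun_add (ih fun j hj => hf j (by simp [hj]))

theorem LipschitzWith.comp_absolutelyContinuousOnInterval {X Y : Type*} [PseudoMetricSpace X]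
    [PseudoMetricSpace Y] {K : NNReal} {g : X → Y} (hg : LipschitzWith K g) {f : ℝ → X} {a b : ℝ}
    (hf : AbsolutelyContinuousOnInterval f a b) :
    AbsolutelyContinuousOnInterval (fun t => g (f t)) a b := by
  have h := Filter.Tendsto.const_mul (K : ℝ) hf
  rw [mul_zero] at h
  refine squeeze_zero (fun E => Finset.sum_nonneg fun i _ => dist_nonneg) (fun E => ?_) h
  rw [Finset.mul_sum]
  exact Finset.sum_le_sum fun i _ => hg.dist_le_mul _ _

section FiniteDimensional

variable {E : Type*} [NormedAddCommGroup E] [NormedSpace ℝ E] [FiniteDimensional ℝ E]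

theorem AbsolutelyContinuousOnInterval.clm_apply {F : Type*} [NormedAddCommGroup F]
    [NormedSpace ℝ F] {Φ : ℝ → E →L[ℝ] F} (hΦ : ContDiff ℝ 1 Φ) {z : ℝ → E} {a b : ℝ}
    (hz : AbsolutelyContinuousOnInterval z a b) :
    AbsolutelyContinuousOnInterval (fun t => Φ t (z t)) a b := by
  set e := Module.finBasis ℝ E
  have h : ∀ t, Φ t (z t) = ∑ i, e.repr (z t) i • Φ t (e i) := fun t => by
    conv_lhs => rw [← e.sum_repr (z t)]
    simp only [map_sum, map_smul]
  simp only [h]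
  refine AbsolutelyContinuousOnInterval.fun_sum _ fun i _ => ?_
  refine AbsolutelyContinuousOnInterval.fun_smul ?_ ?_
  · exact (LinearMap.toContinuousLinearMap (e.coord i)).lipschitz
      |>.comp_absolutelyContinuousOnInterval hz
  · exact (hΦ.clm_apply contDiff_const).contDiffOn.absolutelyContinuousOnInterval

theorem IntervalIntegrable.absolutelyContinuousOnInterval_integral {f : ℝ → E}
    {a b : ℝ} (hf : IntervalIntegrable f volume a b) :
    AbsolutelyContinuousOnInterval (fun t => ∫ s in a..t, f s) a b := by
  have : CompleteSpace E := FiniteDimensional.complete ℝ E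
  set e := Module.finBasis ℝ E
  set c : Fin (Module.finrank ℝ E) → E →L[ℝ] ℝ := fun i =>
    LinearMap.toContinuousLinearMap (e.coord i)
  have hc : ∀ i, IntervalIntegrable (fun s => c i (f s)) volume a b := fun i =>
    ⟨(c i).integrable_comp hf.1, (c i).integrable_comp hf.2⟩
  have h1 : AbsolutelyContinuousOnInterval
      (fun t => ∑ i, (∫ s in a..t, c i (f s)) • e i) a b := by
    refine AbsolutelyContinuousOnInterval.fun_sum _ fun i _ => ?_
    refine AbsolutelyContinuousOnInterval.fun_smul
      ((hc i).absolutelyContinuousOnInterval_intervalIntegral left_mem_uIcc) ?_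
    exact (LipschitzWith.const _).lipschitzOnWith.absolutelyContinuousOnInterval
  have h2 : ∀ t ∈ uIcc a b, (∑ i, (∫ s in a..t, c i (f s)) • e i) = ∫ s in a..t, f s :=
    fun t ht => by
    have hft : IntervalIntegrable f volume a t := hf.mono_set (uIcc_subset_uIcc_left ht)
    conv_rhs => rw [← e.sum_repr (∫ s in a..t, f s)]
    refine Finset.sum_congr rfl fun i _ => ?_
    congr 1
    exact (c i).intervalIntegral_comp_comm hft
  rw [absolutelyContinuousOnInterval_iff] at h1 ⊢
  intro ε hε
  obtain ⟨δ, hδ, h⟩ := h1 ε hε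
  refine ⟨δ, hδ, fun E hE hl => ?_⟩
  refine lt_of_eq_of_lt (Finset.sum_congr rfl fun i hi => ?_) (h E hE hl)
  rw [h2 _ (hE.1 i hi).1, h2 _ (hE.1 i hi).2]

end FiniteDimensional

section Exponential

variable {𝔸 : Type*} [NormedRing 𝔸] [NormedAlgebra ℝ 𝔸] [CompleteSpace 𝔸] (A : 𝔸)

theorem contDiff_exp_smul : ContDiff ℝ 1 fun t : ℝ => NormedSpace.exp (t • A) := by
  rw [contDiff_one_iff_deriv]
  have h : ∀ t, HasDerivAt (fun t : ℝ => NormedSpace.exp (t • A))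
      (A * NormedSpace.exp (t • A)) t := fun t => hasDerivAt_exp_smul_const' A t
  have hd : Differentiable ℝ fun t : ℝ => NormedSpace.exp (t • A) := fun t =>
    (h t).differentiableAt
  refine ⟨hd, ?_⟩
  rw [show deriv (fun t : ℝ => NormedSpace.exp (t • A)) = fun t => A * NormedSpace.exp (t • A)
    from funext fun t => (h t).deriv]
  exact continuous_const.mul hd.continuous

theorem exp_add_smul (s t : ℝ) :
    NormedSpace.exp ((s + t) • A) = NormedSpace.exp (s • A) * NormedSpace.exp (t • A) := by
  let : NormedAlgebra ℚ 𝔸 := NormedAlgebra.restrictScalars ℚ ℝ _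
  rw [add_smul]
  exact NormedSpace.exp_add_of_commute (((Commute.refl A).smul_left s).smul_right t)

end Exponential

section Flow

theorem exp_zero_smul_apply {E : Type*} [NormedAddCommGroup E] [NormedSpace ℝ E]
    (A : E →L[ℝ] E) (x : E) : NormedSpace.exp ((0 : ℝ) • A) x = x := by
  have h : NormedSpace.exp ((0 : ℝ) • A) = 1 := by
    rw [zero_smul]
    exact NormedSpace.exp_zero
  rw [h]
  rfl

variable {E : Type*} [NormedAddCommGroup E] [NormedSpace ℝ E] [FiniteDimensional ℝ E]
  (A : E →L[ℝ] E)

theorem exp_smul_apply_exp_smul (s t : ℝ) (x : E) :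
    NormedSpace.exp (s • A) (NormedSpace.exp (t • A) x) = NormedSpace.exp ((s + t) • A) x := by
  have : CompleteSpace E := FiniteDimensional.complete ℝ E
  exact DFunLike.congr_fun (exp_add_smul A s t).symm x

theorem integrableOn_exp_sub_smul_apply (c : ℝ) {T : ℝ} {h : ℝ → E}
    (hh : IntegrableOn h (Icc 0 T)) :
    IntegrableOn (fun s => NormedSpace.exp ((c - s) • A) (h s)) (Icc 0 T) := by
  have : CompleteSpace E := FiniteDimensional.complete ℝ E
  have hcont : Continuous fun s : ℝ => NormedSpace.exp ((c - s) • A) :=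
    (contDiff_exp_smul A).continuous.comp (continuous_const.sub continuous_id)
  obtain ⟨K, hK⟩ := (isCompact_Icc (a := (0 : ℝ)) (b := T)).exists_bound_of_continuousOn
    hcont.continuousOn
  refine (hh.norm.const_mul K).mono'
    (hcont.aestronglyMeasurable.clm_apply hh.aestronglyMeasurable) ?_
  refine (ae_restrict_mem measurableSet_Icc).mono fun s hs => ?_
  exact (ContinuousLinearMap.le_opNorm _ _).trans
    (mul_le_mul_of_nonneg_right (hK s hs) (norm_nonneg _))

/-- An absolutely continuous solution of `ż = A z + h`, `z(0) = z₀`, given by the variation of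
constants formula. -/
theorem exists_solution {T : ℝ} (hT : 0 ≤ T) {h : ℝ → E}
    (hh : IntervalIntegrable h volume 0 T) (z₀ : E) :
    ∃ z : ℝ → E, AbsolutelyContinuousOnInterval z 0 T ∧ z 0 = z₀ ∧
      (∀ᵐ t ∂(volume.restrict (Icc 0 T)), HasDerivAt z (A (z t) + h t) t) ∧
      z T = NormedSpace.exp (T • A) z₀ +
        ∫ s in (0 : ℝ)..T, NormedSpace.exp ((T - s) • A) (h s) := by
  have : CompleteSpace E := FiniteDimensional.complete ℝ E
  have h0 : IntervalIntegrable (fun s => NormedSpace.exp ((-s) • A) (h s)) volume 0 T := by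
    rw [intervalIntegrable_iff_integrableOn_Icc_of_le hT] at hh ⊢
    simpa using integrableOn_exp_sub_smul_apply A 0 hh
  refine ⟨fun t =>
      NormedSpace.exp (t • A) (z₀ + ∫ s in (0 : ℝ)..t, NormedSpace.exp ((-s) • A) (h s)),
    ?_, ?_, ?_, ?_⟩
  · refine AbsolutelyContinuousOnInterval.clm_apply (contDiff_exp_smul A) ?_
    exact ((LipschitzWith.const _).lipschitzOnWith.absolutelyContinuousOnInterval).fun_add
      h0.absolutelyContinuousOnInterval_integral
  · simp
  · rw [ae_restrict_iff' measurableSet_Icc]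
    filter_upwards [h0.ae_hasDerivAt_integral] with t ht htT
    rw [uIcc_of_le hT] at ht
    have hd := (hasDerivAt_exp_smul_const' A t).clm_apply
      ((ht htT 0 ⟨le_rfl, hT⟩).const_add z₀)
    rw [exp_smul_apply_exp_smul, add_neg_cancel, exp_zero_smul_apply] at hd
    exact hd
  · simp only [map_add]
    congr 1
    rw [← ContinuousLinearMap.intervalIntegral_comp_comm _ h0]
    refine intervalIntegral.integral_congr fun s _ => ?_
    change NormedSpace.exp (T • A) (NormedSpace.exp ((-s) • A) (h s)) = _
    rw [exp_smul_apply_exp_smul, sub_eq_add_neg]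

/-- Absolutely continuous solutions of `ż = A z + h` are determined by `z(0)`: for the difference
`y` of two solutions, `t ↦ e^{-tA} y(t)` is absolutely continuous with derivative zero almost
everywhere. -/
theorem solution_unique {T : ℝ} (hT : 0 ≤ T) {h z w : ℝ → E}
    (hz : AbsolutelyContinuousOnInterval z 0 T) (hw : AbsolutelyContinuousOnInterval w 0 T)
    (h0 : z 0 = w 0)
    (hz' : ∀ᵐ t ∂(volume.restrict (Icc 0 T)), HasDerivAt z (A (z t) + h t) t)
    (hw' : ∀ᵐ t ∂(volume.restrict (Icc 0 T)), HasDerivAt w (A (w t) + h t) t) :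
    z T = w T := by
  have : CompleteSpace E := FiniteDimensional.complete ℝ E
  have hΦ : ContDiff ℝ 1 fun t : ℝ => NormedSpace.exp (t • (-A)) := contDiff_exp_smul (-A)
  have hac := AbsolutelyContinuousOnInterval.clm_apply hΦ (hz.fun_sub hw)
  obtain ⟨c, hc⟩ := hac.const_of_ae_hasDerivAt_zero (by
    rw [ae_restrict_iff' measurableSet_Icc] at hz' hw'
    filter_upwards [hz', hw'] with t h1 h2 ht
    rw [uIcc_of_le hT] at ht
    have hd := (hasDerivAt_exp_smul_const (-A) t).clm_apply ((h1 ht).fun_sub (h2 ht))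
    convert hd using 1
    have h3 : A (z t) + h t - (A (w t) + h t) = A (z t - w t) := by
      rw [map_sub]
      abel
    rw [h3]
    change 0 = NormedSpace.exp (t • (-A)) ((-A) (z t - w t)) + _
    rw [← map_add, neg_apply, neg_add_cancel, map_zero])
  have h1 := hc 0 left_mem_uIcc
  have h2 := hc T right_mem_uIcc
  simp only [h0, sub_self, map_zero] at h1
  rw [← h1] at h2
  have h3 := congrArg (NormedSpace.exp (T • A) : E →L[ℝ] E) h2
  have h4 : T • (-A) = (-T) • A := by rw [neg_smul]; exact smul_neg T A
  rw [h4, exp_smul_apply_exp_smul, add_neg_cancel, exp_zero_smul_apply, map_zero] at h3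
  exact sub_eq_zero.mp h3

end Flow

/-! ### Measurable selection of the element of least norm -/

/-- The projection of a closed set along a compact one is closed. -/
theorem IsCompact.isClosed_setOf_exists_mem {Y E : Type*} [TopologicalSpace Y]
    [TopologicalSpace E] {K : Set E} (hK : IsCompact K) {C : Set (Y × E)} (hC : IsClosed C) :
    IsClosed {y | ∃ u ∈ K, (y, u) ∈ C} := by
  have := isCompact_iff_compactSpace.mp hK
  have h := isClosedMap_fst_of_compactSpace (X := Y) (Y := K)
    _ (hC.preimage (f := fun q : Y × K => (q.1, (q.2 : E))) (by fun_prop))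
  convert h using 1
  ext y
  simp

/-- A set-valued map with closed graph and convex values in a Euclidean space has a Borel
selection, namely its element of least norm. The distance to the origin is lower semicontinuous,
and the least element lies in a compact set `K` exactly when the value meets `K` within that
distance, which is a closed condition. -/
theorem exists_measurable_norm_le_selection {Y E : Type*} [TopologicalSpace Y] [MeasurableSpace Y]
    [OpensMeasurableSpace Y] [NormedAddCommGroup E] [InnerProductSpace ℝ E] [ProperSpace E]
    [MeasurableSpace E] [BorelSpace E] (Γ : Y → Set E)
    (hclosed : IsClosed {q : Y × E | q.2 ∈ Γ q.1}) (hconv : ∀ y, Convex ℝ (Γ y)) :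
    ∃ f : Y → E, Measurable f ∧
      ∀ y, (Γ y).Nonempty → f y ∈ Γ y ∧ ∀ u ∈ Γ y, ‖f y‖ ≤ ‖u‖ := by
  classical
  have hΓ : ∀ y, IsClosed (Γ y) := fun y =>
    hclosed.preimage (f := fun u : E => (y, u)) (by fun_prop)
  have hex : ∀ y, ∃ u : E, ((Γ y).Nonempty → u ∈ Γ y ∧ ∀ w ∈ Γ y, ‖u‖ ≤ ‖w‖) ∧
      (¬ (Γ y).Nonempty → u = 0) := fun y => by
    by_cases h : (Γ y).Nonempty
    · obtain ⟨u, hu, hd⟩ := (hΓ y).exists_infDist_eq_dist h 0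
      refine ⟨u, fun _ => ⟨hu, fun w hw => ?_⟩, fun h' => absurd h h'⟩
      have := Metric.infDist_le_dist_of_mem (x := (0 : E)) hw
      rwa [hd, dist_zero_left, dist_zero_left] at this
    · exact ⟨0, fun h' => absurd h' h, fun _ => rfl⟩
  choose f hf hf0 using hex
  have hball : ∀ r, IsClosed
      {y | ∃ u ∈ Metric.closedBall (0 : E) r, (y, u) ∈ {q : Y × E | q.2 ∈ Γ q.1}} :=
    fun r => (isCompact_closedBall 0 r).isClosed_setOf_exists_mem hclosed
  have hdom : MeasurableSet {y | (Γ y).Nonempty} := by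
    have : {y | (Γ y).Nonempty} = ⋃ j : ℕ,
        {y | ∃ u ∈ Metric.closedBall (0 : E) j, (y, u) ∈ {q : Y × E | q.2 ∈ Γ q.1}} := by
      ext y
      simp only [mem_iUnion, mem_ofPred_eq]
      constructor
      · rintro ⟨u, hu⟩
        obtain ⟨j, hj⟩ := exists_nat_ge ‖u‖
        exact ⟨j, u, by simpa using hj, hu⟩
      · rintro ⟨j, u, -, hu⟩
        exact ⟨u, hu⟩
    rw [this]
    exact MeasurableSet.iUnion fun j => (hball j).measurableSet
  have hN : Measurable fun y => ‖f y‖ := by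
    refine measurable_of_Iic fun r => ?_
    by_cases hr : 0 ≤ r
    · have : (fun y => ‖f y‖) ⁻¹' Iic r = {y | (Γ y).Nonempty}ᶜ ∪
          {y | ∃ u ∈ Metric.closedBall (0 : E) r, (y, u) ∈ {q : Y × E | q.2 ∈ Γ q.1}} := by
        ext y
        simp only [mem_preimage, mem_Iic, mem_union, mem_compl_iff, mem_ofPred_eq,
          mem_closedBall_zero_iff]
        constructor
        · intro h
          by_cases hy : (Γ y).Nonempty
          · exact Or.inr ⟨f y, h, (hf y hy).1⟩
          · exact Or.inl hy
        · rintro (hy | ⟨u, hu, hΓu⟩)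
          · rw [hf0 y hy]; simpa using hr
          · exact ((hf y ⟨u, hΓu⟩).2 u hΓu).trans hu
      rw [this]
      exact hdom.compl.union (hball r).measurableSet
    · have : (fun y => ‖f y‖) ⁻¹' Iic r = ∅ := by
        ext y
        simp only [mem_preimage, mem_Iic, mem_empty_iff_false, iff_false]
        exact fun h => hr ((norm_nonneg _).trans h)
      rw [this]; exact MeasurableSet.empty
  -- by strict convexity of the norm, the midpoint of two least elements would be shorter
  have huniq : ∀ y, ∀ u ∈ Γ y, ‖u‖ ≤ ‖f y‖ → u = f y := fun y u hu hle => by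
    have hy := hf y ⟨u, hu⟩
    by_contra hne
    have hmid := (hy.2 _ (hconv y hu hy.1 (by norm_num : (0 : ℝ) ≤ 1 / 2)
      (by norm_num : (0 : ℝ) ≤ 1 / 2) (by norm_num)))
    have hlt := norm_combo_lt_of_ne hle le_rfl hne (by norm_num : (0 : ℝ) < 1 / 2)
      (by norm_num : (0 : ℝ) < 1 / 2) (by norm_num)
    exact absurd hmid (not_le.mpr hlt)
  refine ⟨f, ?_, fun y hy => hf y hy⟩
  -- preimages of compact sets suffice, since a closed set is a countable union of them
  have hKmeas : ∀ K : Set E, IsCompact K → MeasurableSet (f ⁻¹' K) := fun K hK => by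
    have hC : IsClosed {q : Y × ℝ | ∃ u ∈ K,
        (q, u) ∈ {a : (Y × ℝ) × E | a.2 ∈ Γ a.1.1 ∧ ‖a.2‖ ≤ a.1.2}} := by
      refine hK.isClosed_setOf_exists_mem (IsClosed.inter ?_ ?_)
      · exact hclosed.preimage (f := fun a : (Y × ℝ) × E => (a.1.1, a.2)) (by fun_prop)
      · exact isClosed_le continuous_snd.norm (continuous_snd.comp continuous_fst)
    have hm := hC.measurableSet.preimage (measurable_id.prodMk hN)
    have : f ⁻¹' K = ((fun y => (id y, ‖f y‖)) ⁻¹' {q : Y × ℝ | ∃ u ∈ K,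
        (q, u) ∈ {a : (Y × ℝ) × E | a.2 ∈ Γ a.1.1 ∧ ‖a.2‖ ≤ a.1.2}}) ∪
        ({y | (Γ y).Nonempty}ᶜ ∩ {_y | (0 : E) ∈ K}) := by
      ext y
      simp only [mem_preimage, mem_union, mem_inter_iff, mem_compl_iff, mem_ofPred_eq, id]
      by_cases hy : (Γ y).Nonempty
      · simp only [hy, not_true_eq_false, false_and, or_false]
        constructor
        · exact fun h => ⟨f y, h, (hf y hy).1, le_rfl⟩
        · rintro ⟨u, huK, hu, hle⟩
          rwa [← huniq y u hu hle]
      · simp only [hy, not_false_eq_true, true_and, hf0 y hy]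
        constructor
        · exact Or.inr
        · rintro (⟨u, -, hu, -⟩ | h)
          · exact absurd ⟨u, hu⟩ hy
          · exact h
    rw [this]
    exact hm.union (hdom.compl.inter (MeasurableSet.const _))
  refine measurable_of_isClosed fun D hD => ?_
  have : D = ⋃ j : ℕ, D ∩ Metric.closedBall 0 j := by
    rw [← inter_iUnion, Metric.iUnion_closedBall_nat, inter_univ]
  rw [this, preimage_iUnion]
  exact MeasurableSet.iUnion fun j => hKmeas _ ((isCompact_closedBall 0 _).inter_left hD)

namespace PursuitGame

variable {n m k : ℕ} (G : PursuitGame n m k)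

/-! ### The resolving function -/

theorem resolving_nonneg (F : ℝ → (Euc k →L[ℝ] Euc m)) (z₀ : Euc n) (t τ : ℝ) (v : Euc k) :
    0 ≤ G.resolving F z₀ t τ v :=
  Real.sSup_nonneg fun _ h => h.1

/-- Where the resolving function is positive, the supremum defining it is attained. (A positive
supremum of reals is a genuine one: the set is nonempty and bounded.) In the maximizing sequence
the controls lie in a ball, and the points of `M1` are recovered from them after division by the
multiplier, which stays away from zero. -/
theorem exists_control_of_resolving_pos (hp : 0 < G.p) (hM1 : IsClosed G.M1)
    {F : ℝ → (Euc k →L[ℝ] Euc m)} {z₀ : Euc n} {t τ : ℝ} {v : Euc k}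
    (hδ : 0 ≤ G.delta F) (hpos : 0 < G.resolving F z₀ t τ v) :
    ∃ u : Euc m, ‖u‖ ^ G.p ≤ ‖F (t - τ) v‖ ^ G.p + G.resolving F z₀ t τ v * G.delta F ∧
      G.projFlow t z₀ + (G.resolving F z₀ t τ v)⁻¹ •
        (G.projFlow (t - τ) (G.B u) - G.projFlow (t - τ) (G.C v)) ∈ G.M1 := by
  set S : Set ℝ := {lam : ℝ | 0 ≤ lam ∧
    ((lam • (G.M1 - {G.projFlow t z₀})) ∩ G.setU F t τ v lam).Nonempty} with hS
  have hlam : G.resolving F z₀ t τ v = sSup S := rfl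
  rw [hlam] at hpos ⊢
  have hne : S.Nonempty := by
    by_contra h
    rw [not_nonempty_iff_eq_empty.mp h, Real.sSup_empty] at hpos
    exact lt_irrefl _ hpos
  have hbdd : BddAbove S := by
    by_contra h
    rw [Real.sSup_of_not_bddAbove h] at hpos
    exact lt_irrefl _ hpos
  obtain ⟨l, -, hl, hlS⟩ := exists_seq_tendsto_sSup hne hbdd
  set a : ℝ → ℝ := fun lam => (‖F (t - τ) v‖ ^ G.p + lam * G.delta F) ^ (1 / G.p) with ha
  set g : ℝ × Euc m → Euc n := fun q => G.projFlow t z₀ + q.1⁻¹ •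
    (G.projFlow (t - τ) (G.B (a q.1 • q.2)) - G.projFlow (t - τ) (G.C v)) with hg
  have hacont : Continuous a := by
    refine Continuous.rpow_const (by fun_prop) fun _ => Or.inr ?_
    positivity
  set Q : Set (ℝ × Euc m) := Icc (sSup S / 2) (sSup S) ×ˢ Metric.closedBall 0 1 with hQ
  have hQc : IsCompact Q := isCompact_Icc.prod (isCompact_closedBall _ _)
  have hgc : ContinuousOn g Q := by
    refine continuousOn_const.add (ContinuousOn.fun_smul ?_ ?_)
    · refine continuousOn_fst.inv₀ fun q hq => ?_
      have := hq.1.1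
      exact (lt_of_lt_of_le (half_pos hpos) this).ne'
    · exact Continuous.continuousOn (by fun_prop)
  have hKc : IsCompact (Prod.fst '' (Q ∩ g ⁻¹' G.M1)) :=
    (hQc.of_isClosed_subset (hgc.preimage_isClosed_of_isClosed hQc.isClosed hM1)
      inter_subset_left).image continuous_fst
  have hev : ∀ᶠ j in Filter.atTop, l j ∈ Prod.fst '' (Q ∩ g ⁻¹' G.M1) := by
    filter_upwards [hl.eventually (lt_mem_nhds (half_lt_self hpos))] with j hj
    obtain ⟨-, w, hw1, hw2⟩ := hlS j
    obtain ⟨w', ⟨m', hm', x', hx', rfl⟩, rfl⟩ := hw1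
    rw [mem_singleton_iff] at hx'
    subst hx'
    obtain ⟨b, hb, c, hc, hbc⟩ := hw2
    rw [mem_singleton_iff] at hc
    obtain ⟨b', ⟨s, hs, rfl⟩, rfl⟩ := hb
    have hlj : l j ≠ 0 := ((half_pos hpos).trans hj).ne'
    refine ⟨(l j, s), ⟨⟨⟨hj.le, le_csSup hbdd (hlS j)⟩, hs⟩, ?_⟩, rfl⟩
    have hgm : g (l j, s) = m' := by
      simp only [hg, map_smul]
      subst hc
      have hbc' : a (l j) • G.projFlow (t - τ) (G.B s) - G.projFlow (t - τ) (G.C v)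
          = l j • (m' - G.projFlow t z₀) := hbc
      rw [hbc', inv_smul_smul₀ hlj, add_sub_cancel]
    rw [mem_preimage, hgm]
    exact hm'
  obtain ⟨⟨l', s⟩, ⟨⟨-, hs⟩, hM⟩, hl'⟩ := hKc.isClosed.mem_of_tendsto hl hev
  simp only at hl'
  subst hl'
  have hbase : 0 ≤ ‖F (t - τ) v‖ ^ G.p + sSup S * G.delta F := by positivity
  refine ⟨a (sSup S) • s, ?_, hM⟩
  have hs1 : ‖s‖ ≤ 1 := by simpa using hs
  have ha0 : 0 ≤ a (sSup S) := Real.rpow_nonneg hbase _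
  calc ‖a (sSup S) • s‖ ^ G.p ≤ a (sSup S) ^ G.p := by
        refine Real.rpow_le_rpow (norm_nonneg _) ?_ hp.le
        rw [norm_smul, Real.norm_of_nonneg ha0]
        exact mul_le_of_le_one_right ha0 hs1
    _ = _ := by
        rw [ha, ← Real.rpow_mul hbase, one_div_mul_cancel hp.ne', Real.rpow_one]

/-! ### Measurable controls which realize the resolving function -/

/-- The measurable form of the pursuer's countercontrol. For every time `τ ≤ t` and every value
`v` of the evader's control it spends at most `|F(t-τ)v|^p + λ δ` and pushes the projected state
along `λ (M1 - π e^{tA} z₀)`, with `λ = λ(t,τ,v,z₀)`. Where `λ > 0` it is the control of least norm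
with this property, where `λ = 0` it is `F(t-τ)v`. -/
theorem exists_measurable_control (hp : 0 < G.p) (hM1 : IsClosed G.M1) (hM1c : Convex ℝ G.M1)
    {F : ℝ → (Euc k →L[ℝ] Euc m)} (hF : G.IsMatching F) (hδ : 0 ≤ G.delta F) (z₀ : Euc n) (t : ℝ) :
    ∃ c : ℝ → Euc k → Euc m,
      (∀ τ ∈ Icc 0 t, ∀ v, ‖c τ v‖ ^ G.p ≤
        ‖F (t - τ) v‖ ^ G.p + G.resolving F z₀ t τ v * G.delta F) ∧
      (∀ τ ∈ Icc 0 t, ∀ v, G.projFlow (t - τ) (G.B (c τ v) - G.C v) = 0 ∧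
          G.resolving F z₀ t τ v = 0 ∨
        ∃ x ∈ G.M1, G.projFlow (t - τ) (G.B (c τ v) - G.C v) =
          G.resolving F z₀ t τ v • (x - G.projFlow t z₀)) ∧
      ∀ v : ℝ → Euc k, AEMeasurable v (volume.restrict (Icc 0 t)) →
        AEMeasurable (fun τ => G.resolving F z₀ t τ (v τ)) (volume.restrict (Icc 0 t)) →
        AEMeasurable (fun τ => c τ (v τ)) (volume.restrict (Icc 0 t)) := by
  classical
  -- the parameter is the affine map `u ↦ y.1 u + y.2`, the value its preimage of `M1`
  obtain ⟨f, hfm, hf⟩ := exists_measurable_norm_le_selection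
    (Y := (Euc m →L[ℝ] Euc n) × Euc n) (fun y => {u : Euc m | y.1 u + y.2 ∈ G.M1})
    (hM1.preimage (f := fun q : ((Euc m →L[ℝ] Euc n) × Euc n) × Euc m => q.1.1 q.2 + q.1.2)
      (by fun_prop))
    (fun y => by
      have h := (hM1c.translate_preimage_left y.2).linear_preimage y.1.toLinearMap
      exact h)
  set lam : ℝ → Euc k → ℝ := fun τ v => G.resolving F z₀ t τ v with hlamdef
  set y : ℝ → Euc k → (Euc m →L[ℝ] Euc n) × Euc n := fun τ v =>
    ((lam τ v)⁻¹ • (G.projFlow (t - τ) ∘L G.B),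
      G.projFlow t z₀ - (lam τ v)⁻¹ • G.projFlow (t - τ) (G.C v)) with hy
  have hy_apply : ∀ τ v u, (y τ v).1 u + (y τ v).2 = G.projFlow t z₀ + (lam τ v)⁻¹ •
      (G.projFlow (t - τ) (G.B u) - G.projFlow (t - τ) (G.C v)) := fun τ v u => by
    simp only [hy, smul_apply, ContinuousLinearMap.comp_apply, smul_sub]
    abel
  have hflow : Continuous fun τ : ℝ => G.projFlow (t - τ) := by
    have h := (contDiff_exp_smul G.A).continuous.comp
      (continuous_const.sub continuous_id : Continuous fun τ : ℝ => t - τ)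
    exact continuous_const.clm_comp h
  refine ⟨fun τ v => if 0 < lam τ v then f (y τ v) else F (t - τ) v, ?_, ?_, ?_⟩
  · intro τ hτ v
    simp only
    split_ifs with h
    · obtain ⟨u, hu, hmem⟩ := G.exists_control_of_resolving_pos hp hM1 hδ h
      have hmem' : u ∈ {u : Euc m | (y τ v).1 u + (y τ v).2 ∈ G.M1} := by
        rw [mem_ofPred_eq, hy_apply]
        exact hmem
      exact (Real.rpow_le_rpow (norm_nonneg _) ((hf _ ⟨u, hmem'⟩).2 u hmem') hp.le).trans hu
    · exact le_add_of_nonneg_right (mul_nonneg (G.resolving_nonneg F z₀ t τ v) hδ)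
  · intro τ hτ v
    simp only
    split_ifs with h
    · right
      obtain ⟨u, hu, hmem⟩ := G.exists_control_of_resolving_pos hp hM1 hδ h
      have hmem' : u ∈ {u : Euc m | (y τ v).1 u + (y τ v).2 ∈ G.M1} := by
        rw [mem_ofPred_eq, hy_apply]
        exact hmem
      have h1 := (hf _ ⟨u, hmem'⟩).1
      rw [mem_ofPred_eq, hy_apply] at h1
      refine ⟨_, h1, ?_⟩
      rw [add_sub_cancel_left, smul_inv_smul₀ h.ne', map_sub]
    · left
      refine ⟨?_, le_antisymm (not_lt.mp h) (G.resolving_nonneg F z₀ t τ v)⟩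
      have h2 := DFunLike.congr_fun (hF.2 (t - τ) (sub_nonneg.mpr hτ.2)) v
      simp only [ContinuousLinearMap.comp_apply] at h2
      rw [map_sub, h2, sub_self]
  · intro v hv hl
    have hFv : AEMeasurable (fun τ => F (t - τ) (v τ)) (volume.restrict (Icc 0 t)) := by
      have hFc : ContinuousOn (fun τ => F (t - τ)) (Icc 0 t) :=
        hF.1.comp (continuousOn_const.sub continuousOn_id) fun τ hτ => sub_nonneg.mpr hτ.2
      exact ((hFc.aestronglyMeasurable measurableSet_Icc).clm_apply
        hv.aestronglyMeasurable).aemeasurable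
    have hymeas : AEMeasurable (fun τ => y τ (v τ)) (volume.restrict (Icc 0 t)) := by
      refine AEMeasurable.prodMk ?_ ?_
      · exact hl.inv.smul (hflow.clm_comp continuous_const).measurable.aemeasurable
      · refine aemeasurable_const.sub (hl.inv.smul ?_)
        exact (hflow.aestronglyMeasurable.clm_apply
          (G.C.continuous.measurable.comp_aemeasurable hv).aestronglyMeasurable).aemeasurable
    have hset : NullMeasurableSet {τ | 0 < lam τ (v τ)} (volume.restrict (Icc 0 t)) :=
      nullMeasurableSet_lt aemeasurable_const hl
    refine (((hfm.comp_aemeasurable hymeas).indicator₀ hset).add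
      (hFv.indicator₀ hset.compl)).congr (Filter.Eventually.of_forall fun τ => ?_)
    by_cases h : 0 < lam τ (v τ)
    · simp [h]
    · simp [h]

end PursuitGame

/-! ### Integral constraints -/

theorem mem_controlBall_of_lintegral_le {d : ℕ} {p : ℝ} (hp : 0 < p) {J : Set ℝ} {r : ℝ}
    (hr : 0 ≤ r) {w : ℝ → Euc d} (hw : AEStronglyMeasurable w (volume.restrict J))
    (h : ∫⁻ τ in J, ‖w τ‖ₑ ^ p ≤ ENNReal.ofReal (r ^ p)) : w ∈ controlBall p J r := by
  have hp0 : ENNReal.ofReal p ≠ 0 := by simpa using hp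
  have hpr : (ENNReal.ofReal p).toReal = p := ENNReal.toReal_ofReal hp.le
  constructor
  · refine ⟨hw, ?_⟩
    rw [eLpNorm_lt_top_iff_lintegral_rpow_enorm_lt_top hp0 ENNReal.ofReal_ne_top, hpr]
    exact h.trans_lt ENNReal.ofReal_lt_top
  · rw [integral_eq_lintegral_of_nonneg_ae
      (Filter.Eventually.of_forall fun τ => Real.rpow_nonneg (norm_nonneg _) _)
      (hw.norm.aemeasurable.pow_const p).aestronglyMeasurable]
    refine ENNReal.toReal_le_of_le_ofReal (by positivity) (le_trans (le_of_eq ?_) h)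
    refine lintegral_congr fun τ => ?_
    rw [← ENNReal.ofReal_rpow_of_nonneg (norm_nonneg _) hp.le, ofReal_norm]

theorem controlBall_mono {d : ℕ} {p : ℝ} (hp : 0 < p) {J K : Set ℝ} (hJK : J ⊆ K) {r : ℝ} :
    controlBall (d := d) p K r ⊆ controlBall p J r := fun w hw => by
  refine ⟨hw.1.mono_measure (Measure.restrict_mono hJK le_rfl), le_trans ?_ hw.2⟩
  have hint := hw.1.integrable_norm_rpow (by simpa using hp) ENNReal.ofReal_ne_top
  rw [ENNReal.toReal_ofReal hp.le] at hint
  exact setIntegral_mono_set hint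
    (Filter.Eventually.of_forall fun τ => Real.rpow_nonneg (norm_nonneg _) _)
    (Filter.Eventually.of_forall hJK)

theorem smul_mem_controlBall {d : ℕ} {p : ℝ} {J : Set ℝ} {r c : ℝ} (hc : 0 ≤ c) (hr : 0 ≤ r)
    {w : ℝ → Euc d} (hw : w ∈ controlBall p J r) :
    (fun τ => c • w τ) ∈ controlBall p J (c * r) := by
  refine ⟨hw.1.const_smul c, ?_⟩
  have h : ∀ τ, ‖c • w τ‖ ^ p = c ^ p * ‖w τ‖ ^ p := fun τ => by
    rw [norm_smul, Real.norm_of_nonneg hc, Real.mul_rpow hc (norm_nonneg _)]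
  simp only [h]
  rw [integral_const_mul, Real.mul_rpow hc hr]
  exact mul_le_mul_of_nonneg_left hw.2 (Real.rpow_nonneg hc _)

/-- If an integrable function is nonnegative and its integral over `[0, T]` is at least `1`, its
primitive reaches the value `1` for a last time `s`, and does not exceed `1` exactly up to `s`. -/
theorem exists_setIntegral_Icc_eq_one {T : ℝ} (hT : 0 ≤ T) {l : ℝ → ℝ} (hl0 : ∀ τ, 0 ≤ l τ)
    (hl : IntegrableOn l (Icc 0 T)) (h1 : 1 ≤ ∫ τ in Icc 0 T, l τ) :
    ∃ s ∈ Icc 0 T, ∫ τ in Icc 0 s, l τ = 1 ∧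
      ∀ t ∈ Icc 0 T, ∫ τ in Icc 0 t, l τ ≤ 1 ↔ t ≤ s := by
  set I : ℝ → ℝ := fun t => ∫ τ in Icc 0 t, l τ with hI
  have hc : ContinuousOn I (Icc 0 T) := intervalIntegral.continuousOn_primitive_Icc hl
  have hmono : ∀ a b, b ∈ Icc 0 T → a ≤ b → I a ≤ I b := fun a b hb hab =>
    setIntegral_mono_set (hl.mono_set (Icc_subset_Icc_right hb.2))
      (Filter.Eventually.of_forall hl0) (Filter.Eventually.of_forall (Icc_subset_Icc_right hab))
  have hKc : IsCompact (Icc 0 T ∩ I ⁻¹' Iic 1) :=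
    isCompact_Icc.of_isClosed_subset (hc.preimage_isClosed_of_isClosed isClosed_Icc isClosed_Iic)
      inter_subset_left
  obtain ⟨s, hs, hmax⟩ := hKc.exists_isGreatest
    ⟨0, ⟨le_rfl, hT⟩, by simp [hI]⟩
  have hs1 : I s = 1 := by
    obtain ⟨t, ht, hIt⟩ := intermediate_value_Icc hs.1.2
      (hc.mono (Icc_subset_Icc_left hs.1.1)) ⟨hs.2, h1⟩
    have hts : t ≤ s := hmax ⟨⟨hs.1.1.trans ht.1, ht.2⟩, hIt.le⟩
    rw [le_antisymm ht.1 hts, hIt]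
  refine ⟨s, hs.1, hs1, fun t ht => ⟨fun h => hmax ⟨ht, h⟩, fun h => ?_⟩⟩
  exact (hmono t s hs.1 h).trans hs1.le

namespace PursuitGame

variable {n m k : ℕ} (G : PursuitGame n m k)

/-- By homogeneity, the cost of the control `F(t-τ)v(τ)` which neutralizes the evader is at most
`σ^p ν^p`. -/
theorem lintegral_matching_le (hp : 0 < G.p) (hσ : 0 < G.σ) (F : ℝ → (Euc k →L[ℝ] Euc m))
    {t : ℝ} (ht : 0 ≤ t) {v : ℝ → Euc k} (hv : v ∈ controlBall G.p (Icc 0 t) G.σ) :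
    ∫⁻ τ in Icc 0 t, ‖F (t - τ) (v τ)‖ₑ ^ G.p ≤ ENNReal.ofReal (G.σ ^ G.p) * G.nuPow F := by
  have hω := smul_mem_controlBall (inv_nonneg.mpr hσ.le) hσ.le hv
  rw [inv_mul_cancel₀ hσ.ne'] at hω
  have h1 : ∫⁻ τ in Icc 0 t, ‖F (t - τ) (G.σ⁻¹ • v τ)‖ₑ ^ G.p ≤ G.nuPow F :=
    (le_iSup₂ (f := fun (ω : ℝ → Euc k) (_ : ω ∈ controlBall (d := k) G.p (Icc 0 t) 1) =>
      ∫⁻ τ in Icc 0 t, ‖F (t - τ) (ω τ)‖ₑ ^ G.p) _ hω).trans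
    (le_iSup₂ (f := fun (t : ℝ) (_ : t ∈ Ici (0 : ℝ)) => G.chiPow F t) t ht)
  refine le_trans (le_of_eq ?_) (mul_le_mul_right h1 _)
  rw [← lintegral_const_mul' _ _ ENNReal.ofReal_ne_top]
  refine lintegral_congr fun τ => ?_
  rw [← ENNReal.ofReal_rpow_of_nonneg hσ.le hp.le, ← ENNReal.mul_rpow_of_nonneg _ _ hp.le]
  congr 1
  rw [map_smul, enorm_smul, ← mul_assoc, ← ofReal_norm (G.σ⁻¹), Real.norm_of_nonneg
    (inv_nonneg.mpr hσ.le), ← ENNReal.ofReal_mul hσ.le, mul_inv_cancel₀ hσ.ne', ENNReal.ofReal_one,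
    one_mul]

/-! ### The endpoint of the trajectory -/

/-- If the resolving function is accumulated exactly up to the amount `1`, then the projection of
the endpoint of the trajectory is a weighted mean of points of `M1`; otherwise a hyperplane would
separate it from `M1`. -/
theorem mem_terminalSet_of_integral_eq_one (hM1 : IsClosed G.M1) (hM1c : Convex ℝ G.M1)
    {z₀ zT : Euc n} {T s : ℝ} (hs : s ∈ Icc 0 T) {l : ℝ → ℝ} {h : ℝ → Euc n}
    (hh : IntegrableOn h (Icc 0 T)) (hl : IntegrableOn l (Icc 0 s))
    (hl1 : ∫ τ in Icc 0 s, l τ = 1)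
    (hzT : zT = NormedSpace.exp (T • G.A) z₀ +
      ∫ τ in (0 : ℝ)..T, NormedSpace.exp ((T - τ) • G.A) (h τ))
    (hle : ∀ τ ∈ Icc 0 s, G.projFlow (T - τ) (h τ) = 0 ∧ l τ = 0 ∨
      ∃ x ∈ G.M1, G.projFlow (T - τ) (h τ) = l τ • (x - G.projFlow T z₀))
    (hl0 : ∀ τ, 0 ≤ l τ)
    (hgt : ∀ τ ∈ Icc 0 T, s < τ → G.projFlow (T - τ) (h τ) = 0) :
    zT ∈ G.terminalSet := by
  have hT : 0 ≤ T := hs.1.trans hs.2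
  have hEint := integrableOn_exp_sub_smul_apply G.A T hh
  have hgint : IntegrableOn (fun τ => G.projFlow (T - τ) (h τ)) (Icc 0 T) :=
    G.proj.integrable_comp hEint
  have hproj : G.proj zT = G.projFlow T z₀ + ∫ τ in Icc 0 T, G.projFlow (T - τ) (h τ) := by
    rw [hzT, map_add, intervalIntegral.integral_of_le hT, ← integral_Icc_eq_integral_Ioc,
      ← ContinuousLinearMap.integral_comp_comm _ hEint]
    rfl
  have hsub : ∫ τ in Icc 0 T, G.projFlow (T - τ) (h τ) =
      ∫ τ in Icc 0 s, G.projFlow (T - τ) (h τ) :=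
    (setIntegral_eq_of_subset_of_forall_sdiff_eq_zero measurableSet_Icc (Icc_subset_Icc_right hs.2)
      fun τ hτ => hgt τ hτ.1 (not_le.mp fun h' => hτ.2 ⟨hτ.1.1, h'⟩))
  have hmem : G.proj zT ∈ G.M1 := by
    by_contra hnot
    obtain ⟨f, c, hfc, hcf⟩ := geometric_hahn_banach_closed_point hM1c hM1 hnot
    rw [hproj, hsub, map_add] at hcf
    have hgs := hgint.mono_set (Icc_subset_Icc_right hs.2)
    have hbound : f (∫ τ in Icc 0 s, G.projFlow (T - τ) (h τ)) ≤ c - f (G.projFlow T z₀) := by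
      rw [← ContinuousLinearMap.integral_comp_comm _ hgs]
      calc ∫ τ in Icc 0 s, f (G.projFlow (T - τ) (h τ))
          ≤ ∫ τ in Icc 0 s, l τ * (c - f (G.projFlow T z₀)) := by
            refine setIntegral_mono_on (f.integrable_comp hgs) (hl.mul_const _) measurableSet_Icc
              fun τ hτ => ?_
            rcases hle τ hτ with ⟨h0, hl00⟩ | ⟨x, hx, hxe⟩
            · rw [h0, hl00, map_zero, zero_mul]
            · rw [hxe, map_smul, map_sub, smul_eq_mul]
              exact mul_le_mul_of_nonneg_left (sub_le_sub_right (hfc x hx).le _) (hl0 τ)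
        _ = c - f (G.projFlow T z₀) := by
            rw [integral_mul_const, hl1, one_mul]
    linarith
  -- `zT - π zT` lies in the orthogonal complement of `L`, which is `M0`
  refine ⟨zT - G.proj zT, ?_, G.proj zT, hmem, sub_add_cancel _ _⟩
  have h1 := Submodule.sub_starProjection_mem_orthogonal (K := G.M0ᗮ) zT
  rwa [Submodule.orthogonal_orthogonal] at h1

/-! ### The pursuit strategy -/

theorem ofReal_delta_add (hρ : 0 < G.ρ) (hσ : 0 < G.σ)
    {F : ℝ → (Euc k →L[ℝ] Euc m)}
    (hν : ENNReal.ofReal (G.σ ^ G.p) * G.nuPow F < ENNReal.ofReal (G.ρ ^ G.p)) :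
    0 < G.delta F ∧ ENNReal.ofReal (G.σ ^ G.p) * G.nuPow F + ENNReal.ofReal (G.delta F) =
      ENNReal.ofReal (G.ρ ^ G.p) := by
  have hσp : 0 < G.σ ^ G.p := Real.rpow_pos_of_pos hσ _
  have hfin : G.nuPow F ≠ ⊤ := fun h => by
    rw [h, ENNReal.mul_top (by simpa using hσp)] at hν
    exact not_top_lt hν
  have hcost : ENNReal.ofReal (G.σ ^ G.p) * G.nuPow F =
      ENNReal.ofReal (G.σ ^ G.p * (G.nuPow F).toReal) := by
    rw [ENNReal.ofReal_mul hσp.le, ENNReal.ofReal_toReal hfin]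
  have hnn : 0 ≤ G.σ ^ G.p * (G.nuPow F).toReal := by positivity
  rw [hcost] at hν ⊢
  have hδ : 0 < G.delta F := sub_pos.mpr ((ENNReal.ofReal_lt_ofReal_iff (by positivity)).mp hν)
  refine ⟨hδ, ?_⟩
  rw [← ENNReal.ofReal_add hnn hδ.le, delta]
  congr 1
  ring

/-- At a root of `Λ`, every admissible control of the evader accumulates at least `1`; in
particular, the resolving function is integrable along it, since the integral of a
non-integrable function is `0` by convention. -/
theorem one_le_integral_resolving {F : ℝ → (Euc k →L[ℝ] Euc m)} {z₀ : Euc n} {T : ℝ}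
    (hT : G.bigLambda F z₀ T = 0) {v : ℝ → Euc k} (hv : v ∈ controlBall G.p (Icc 0 T) G.σ) :
    IntegrableOn (fun τ => G.resolving F z₀ T τ (v τ)) (Icc 0 T) ∧
      1 ≤ ∫ τ in Icc 0 T, G.resolving F z₀ T τ (v τ) := by
  have h1 : 1 ≤ ∫ τ in Icc 0 T, G.resolving F z₀ T τ (v τ) := by
    rw [bigLambda, sub_eq_zero] at hT
    rw [hT]
    refine csInf_le ⟨0, ?_⟩ ⟨v, hv, rfl⟩
    rintro _ ⟨w, -, rfl⟩
    exact integral_nonneg fun τ => G.resolving_nonneg F z₀ T τ (w τ)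
  refine ⟨?_, h1⟩
  by_contra h
  rw [integral_undef h] at h1
  exact absurd h1 (by norm_num)

open Classical in
/-- The extension by zero of a function on `[0, t]`. -/
def extendIcc {α : Type*} [Zero α] (t : ℝ) (w : Icc (0 : ℝ) t → α) (τ : ℝ) : α :=
  if h : τ ∈ Icc 0 t then w ⟨τ, h⟩ else 0

theorem extendIcc_domRestrict {α : Type*} [Zero α] {t τ : ℝ} (v : ℝ → α) (h : τ ∈ Icc 0 t) :
    extendIcc t ((Icc 0 t).domRestrict v) τ = v τ := by
  rw [extendIcc, dif_pos h]
  rfl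

open Classical in
/-- The strategy which plays the countercontrol `c` as long as the resolving function, accumulated
along the observed control of the evader, does not exceed `1`, then the neutralizing control
`F(T-t)v(t)` until the time `T`, and nothing outside `[0, T]`. -/
def resolvingStrategy (F : ℝ → (Euc k →L[ℝ] Euc m)) (z₀ : Euc n) (T : ℝ)
    (c : ℝ → Euc k → Euc m) : Strategy m k := fun t w =>
  if t ∈ Icc 0 T then
    if ∫ τ in Icc 0 t, G.resolving F z₀ T τ (extendIcc t w τ) ≤ 1 then c t (extendIcc t w t)
    else F (T - t) (extendIcc t w t)
  else 0

theorem response_resolvingStrategy_of_notMem (F : ℝ → (Euc k →L[ℝ] Euc m)) (z₀ : Euc n) {T t : ℝ}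
    (c : ℝ → Euc k → Euc m) (v : ℝ → Euc k) (ht : t ∉ Icc 0 T) :
    (G.resolvingStrategy F z₀ T c).response v t = 0 :=
  if_neg ht

open Classical in
theorem response_resolvingStrategy_of_mem (F : ℝ → (Euc k →L[ℝ] Euc m)) (z₀ : Euc n) {T t : ℝ}
    (c : ℝ → Euc k → Euc m) (v : ℝ → Euc k) (ht : t ∈ Icc 0 T) :
    (G.resolvingStrategy F z₀ T c).response v t =
      if ∫ τ in Icc 0 t, G.resolving F z₀ T τ (v τ) ≤ 1 then c t (v t) else F (T - t) (v t) := by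
  have h : ∫ τ in Icc 0 t, G.resolving F z₀ T τ (extendIcc t ((Icc 0 t).domRestrict v) τ) =
      ∫ τ in Icc 0 t, G.resolving F z₀ T τ (v τ) :=
    setIntegral_congr_fun measurableSet_Icc fun τ hτ => by
      simp only [extendIcc_domRestrict v hτ]
  rw [Strategy.response, resolvingStrategy, if_pos ht, h, extendIcc_domRestrict v ⟨ht.1, le_rfl⟩]

end PursuitGame

theorem mainTheorem1 {n m k : ℕ} (G : PursuitGame n m k)
    (hp : 1 < G.p) (hρ : 0 < G.ρ) (hσ : 0 < G.σ)
    (hM1_closed : IsClosed G.M1) (hM1_convex : Convex ℝ G.M1)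
    (hM1_sub : G.M1 ⊆ (G.M0ᗮ : Submodule ℝ (Euc n)))
    (F : ℝ → (Euc k →L[ℝ] Euc m)) (hF : G.IsMatching F)
    (hν : ENNReal.ofReal (G.σ ^ G.p) * G.nuPow F < ENNReal.ofReal (G.ρ ^ G.p))
    (z₀ : Euc n) (T : ℝ) (hT : G.IsFirstRoot F z₀ T) :
    G.CanCompletePursuit z₀ T := by
  classical
  have hp0 : 0 < G.p := zero_lt_one.trans hp
  obtain ⟨⟨hTpos, -, hΛ⟩, -⟩ := hT
  obtain ⟨hδ, hbudget⟩ := G.ofReal_delta_add hρ hσ hν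
  obtain ⟨c, hc_cost, hc_push, hc_meas⟩ :=
    G.exists_measurable_control hp0 hM1_closed hM1_convex hF hδ.le z₀ T
  refine ⟨G.resolvingStrategy F z₀ T c, fun v hv => ?_⟩
  set u : ℝ → Euc m := (G.resolvingStrategy F z₀ T c).response v with hu
  have hvT : v ∈ controlBall G.p (Icc 0 T) G.σ := controlBall_mono hp0 Icc_subset_Ici_self hv
  obtain ⟨hlint, hl1⟩ := G.one_le_integral_resolving hΛ hvT
  obtain ⟨s, hs, hls, hsw⟩ := exists_setIntegral_Icc_eq_one hTpos.le
    (fun τ => G.resolving_nonneg F z₀ T τ (v τ)) hlint hl1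
  have hvm : AEMeasurable v (volume.restrict (Icc 0 T)) :=
    hvT.1.aestronglyMeasurable.aemeasurable
  have hlm := hlint.aestronglyMeasurable.aemeasurable
  have hout : ∀ t, t ∉ Icc 0 T → u t = 0 := fun t ht =>
    G.response_resolvingStrategy_of_notMem F z₀ c v ht
  have hin : ∀ t ∈ Icc 0 T, u t = if t ≤ s then c t (v t) else F (T - t) (v t) := fun t ht => by
    rw [hu, G.response_resolvingStrategy_of_mem F z₀ c v ht]
    simp only [hsw t ht]
  have hFv : AEMeasurable (fun τ => F (T - τ) (v τ)) (volume.restrict (Icc 0 T)) := by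
    have hFc : ContinuousOn (fun τ => F (T - τ)) (Icc 0 T) :=
      hF.1.comp (continuousOn_const.sub continuousOn_id) fun τ hτ => sub_nonneg.mpr hτ.2
    exact ((hFc.aestronglyMeasurable measurableSet_Icc).clm_apply
      hvm.aestronglyMeasurable).aemeasurable
  have hum : AEMeasurable u (volume.restrict (Icc 0 T)) := by
    refine (((hc_meas v hvm hlm).indicator (measurableSet_Iic (a := s))).add
      (hFv.indicator (measurableSet_Iic (a := s)).compl)).congr ?_
    refine (ae_restrict_mem measurableSet_Icc).mono fun τ hτ => ?_
    rw [hin τ hτ]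
    by_cases h : τ ≤ s
    · simp [h]
    · simp [h, not_le.mp h]
  have hu_ind : (Icc 0 T).indicator u = u := by
    ext1 t
    by_cases ht : t ∈ Icc 0 T
    · exact indicator_of_mem ht u
    · rw [indicator_of_notMem ht, hout t ht]
  have hum' : AEStronglyMeasurable u (volume.restrict (Ici 0)) := by
    rw [← hu_ind]
    exact (((aestronglyMeasurable_indicator_iff measurableSet_Icc).mpr
      hum.aestronglyMeasurable)).restrict
  -- the cost: at most `σ^p ν^p` for neutralizing the evader, and exactly `δ` for the pursuit
  have hcost : ∫⁻ τ in Ici 0, ‖u τ‖ₑ ^ G.p ≤ ENNReal.ofReal (G.ρ ^ G.p) := by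
    have h1 : ∫⁻ τ in Ici 0, ‖u τ‖ₑ ^ G.p = ∫⁻ τ in Icc 0 T, ‖u τ‖ₑ ^ G.p := by
      rw [← lintegral_indicator measurableSet_Ici, ← lintegral_indicator measurableSet_Icc]
      refine lintegral_congr fun τ => ?_
      by_cases hτ : τ ∈ Icc 0 T
      · rw [indicator_of_mem hτ, indicator_of_mem (Icc_subset_Ici_self hτ)]
      · rw [indicator_of_notMem hτ]
        by_cases hτ' : τ ∈ Ici (0 : ℝ)
        · rw [indicator_of_mem hτ', hout τ hτ, enorm_zero, ENNReal.zero_rpow_of_pos hp0]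
        · rw [indicator_of_notMem hτ']
    have h2 : ∀ τ ∈ Icc 0 T, ‖u τ‖ₑ ^ G.p ≤ ‖F (T - τ) (v τ)‖ₑ ^ G.p +
        (Icc 0 s).indicator (fun τ => ENNReal.ofReal (G.resolving F z₀ T τ (v τ)) *
          ENNReal.ofReal (G.delta F)) τ := fun τ hτ => by
      rw [hin τ hτ]
      by_cases h : τ ≤ s
      · rw [if_pos h, indicator_of_mem (show τ ∈ Icc 0 s from ⟨hτ.1, h⟩),
          ← ENNReal.ofReal_mul (G.resolving_nonneg F z₀ T τ (v τ)), ← ofReal_norm, ← ofReal_norm,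
          ENNReal.ofReal_rpow_of_nonneg (norm_nonneg _) hp0.le,
          ENNReal.ofReal_rpow_of_nonneg (norm_nonneg _) hp0.le,
          ← ENNReal.ofReal_add (by positivity)
            (mul_nonneg (G.resolving_nonneg F z₀ T τ (v τ)) hδ.le)]
        exact ENNReal.ofReal_le_ofReal (hc_cost τ hτ (v τ))
      · rw [if_neg h]
        exact le_self_add
    have h3 : ∫⁻ τ in Icc 0 s, ENNReal.ofReal (G.resolving F z₀ T τ (v τ)) = 1 := by
      rw [← ofReal_integral_eq_lintegral_ofReal (hlint.mono_set (Icc_subset_Icc_right hs.2))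
        (Filter.Eventually.of_forall fun τ => G.resolving_nonneg F z₀ T τ (v τ)), hls,
        ENNReal.ofReal_one]
    calc ∫⁻ τ in Ici 0, ‖u τ‖ₑ ^ G.p
        ≤ ∫⁻ τ in Icc 0 T, (‖F (T - τ) (v τ)‖ₑ ^ G.p +
          (Icc 0 s).indicator (fun τ => ENNReal.ofReal (G.resolving F z₀ T τ (v τ)) *
            ENNReal.ofReal (G.delta F)) τ) := by
          rw [h1]
          exact setLIntegral_mono' measurableSet_Icc h2
      _ = (∫⁻ τ in Icc 0 T, ‖F (T - τ) (v τ)‖ₑ ^ G.p) +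
          ∫⁻ τ in Icc 0 s, ENNReal.ofReal (G.resolving F z₀ T τ (v τ)) *
            ENNReal.ofReal (G.delta F) := by
          rw [lintegral_add_left' (hFv.enorm.pow_const _), setLIntegral_indicator measurableSet_Icc,
            inter_eq_left.mpr (Icc_subset_Icc_right hs.2)]
      _ ≤ ENNReal.ofReal (G.σ ^ G.p) * G.nuPow F + ENNReal.ofReal (G.delta F) := by
          rw [lintegral_mul_const' _ _ ENNReal.ofReal_ne_top, h3, one_mul]
          gcongr
          exact G.lintegral_matching_le hp0 hσ F hTpos.le hvT
      _ = ENNReal.ofReal (G.ρ ^ G.p) := hbudget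
  have hu_adm : G.AdmissibleU u := mem_controlBall_of_lintegral_le hp0 hρ.le hum' hcost
  have hp1 : 1 ≤ ENNReal.ofReal G.p := ENNReal.one_le_ofReal.mpr hp.le
  have hh : IntegrableOn (fun τ => G.B (u τ) - G.C (v τ)) (Icc 0 T) :=
    (G.B.integrable_comp ((controlBall_mono hp0 Icc_subset_Ici_self hu_adm).1.integrable hp1)).sub
      (G.C.integrable_comp (hvT.1.integrable hp1))
  obtain ⟨z, hzac, hz0, hzd, hzT⟩ := exists_solution G.A hTpos.le
    ((intervalIntegrable_iff_integrableOn_Icc_of_le hTpos.le).mpr hh) z₀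
  have hzd' : ∀ᵐ t ∂(volume.restrict (Icc 0 T)),
      HasDerivAt z (G.A (z t) + G.B (u t) - G.C (v t)) t := by
    simpa only [add_sub_assoc] using hzd
  have hend : z T ∈ G.terminalSet := by
    refine G.mem_terminalSet_of_integral_eq_one hM1_closed hM1_convex hs hh
      (hlint.mono_set (Icc_subset_Icc_right hs.2)) hls hzT ?_
      (fun τ => G.resolving_nonneg F z₀ T τ (v τ)) ?_
    · intro τ hτ
      have hτT : τ ∈ Icc 0 T := ⟨hτ.1, hτ.2.trans hs.2⟩
      rw [hin τ hτT, if_pos hτ.2]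
      exact hc_push τ hτT (v τ)
    · intro τ hτ hsτ
      have h2 := DFunLike.congr_fun (hF.2 (T - τ) (sub_nonneg.mpr hτ.2)) (v τ)
      simp only [ContinuousLinearMap.comp_apply] at h2
      rw [hin τ hτ, if_neg (not_le.mpr hsτ), map_sub, h2, sub_self]
  refine ⟨hu_adm, ⟨z, hzac, hz0, hzd'⟩, fun w hw => ⟨T, ⟨hTpos.le, le_rfl⟩, ?_⟩⟩
  rwa [solution_unique G.A hTpos.le hw.1 hzac (hw.2.1.trans hz0.symm)
    (by simpa only [add_sub_assoc] using hw.2.2) hzd]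

end
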